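/- Let $X$ be the adjacency matrix of a simple undirected graph on $n\ge 1$ nodes (a symmetric $0/1$ matrix of size $n\times n$ with zero diagonal), with degrees $X_{i+}=\sum_j X_{ij}$ and total $X_{++}=\sum_{i,j}X_{ij}$. For $i\ne j$ let $\varepsilon_{ij}:\mathbb R^2\to\mathbb R$ be smooth with $\varepsilon_{ij}(x,y)=\varepsilon_{ji}(y,x)$, and suppose that $C_0$ is a constant such that, for all $i\neq j$ and all $\alpha\in\mathbb R^n$, the function $\alpha\mapsto\varepsilon_{ij}(\alpha_i,\alpha_j)$ and all its partial derivatives of orders one, two and three with respect to the coordinates of $\alpha$ are bounded in absolute value by $C_0\exp(\alpha_i+\alpha_j)$. For $\alpha\in\mathbb R^n$ define $p_{ij}(\alpha)$ by $\log p_{ij}(\alpha)=\alpha_i+\alpha_j+\varepsilon_{ij}(\alpha_i,\alpha_j)$, and for $p=(p_{ij})$ let $$\ell(p)=\sum_{i<j}\bigl\{X_{ij}\log p_{ij}+(1-X_{ij})\log(1-p_{ij})\bigr\}$$ be the Bernoulli log-likelihood. Put $\tilde\alpha_i=\log X_{i+}-\log\sqrt{X_{++}}$, $\tilde p_{ij}=X_{i+}X_{j+}/X_{++}$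 and $\tilde\ell=\ell(\tilde p)$. Let $\varepsilon_0\in\mathbb R$ satisfy $1\le X_{i+}^2\le\varepsilon_0X_{++}$ for all $i$ and $\varepsilon_0\le\{15(C_0+1)\}^{-2}$. Then there is a solution $\hat\alpha\in\mathbb R^n$ of the likelihood equation (that is, $p_{ij}(\hat\alpha)<1$ for all $i\ne j$, and the gradient of $\alpha\mapsto\ell(p(\alpha))$ vanishes at $\hat\alpha$) such that $\|\hat\alpha-\tilde\alpha\|_\infty\le 10(C_0+1)\varepsilon_0$. Moreover $\tilde\ell\ne0$, and for every such solution $\hat\alpha$ the value $\hat\ell=\ell(p(\hat\alpha))$ satisfies $$\left|\frac{\hat\ell-\tilde\ell}{\tilde\ell}\right|\le 49(C_0+1)\varepsilon_0 .$$ -/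

import Mathlib

open scoped ContDiff

noncomputable section

namespace NullModel

variable {n : ℕ}

/-- The degree `X_{i+} = ∑ j, X_{ij}` of node `i`. -/
def deg (X : Matrix (Fin n) (Fin n) ℝ) (i : Fin n) : ℝ :=
  ∑ j, X i j

/-- The sum `X_{++}` of all entries of `X`, which is twice the number of edges. -/
def total (X : Matrix (Fin n) (Fin n) ℝ) : ℝ :=
  ∑ i, ∑ j, X i j

/-- The degree-based parameter estimate `log X_{i+} - log √X_{++}`. -/
def alphaTilde (X : Matrix (Fin n) (Fin n) ℝ) : Fin n → ℝ :=
  fun i => Real.log (deg X i) - Real.log (Real.sqrt (total X))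

/-- The degree-based edge probability estimate `X_{i+} X_{j+} / X_{++}`. -/
def pTilde (X : Matrix (Fin n) (Fin n) ℝ) (i j : Fin n) : ℝ :=
  deg X i * deg X j / total X

/-- The edge probabilities of the model with
`log p_{ij}(α) = α_i + α_j + ε_{ij}(α_i, α_j)`; only the values with `i ≠ j` are used. -/
def prob (ε : Fin n → Fin n → ℝ → ℝ → ℝ) (α : Fin n → ℝ) (i j : Fin n) : ℝ :=
  Real.exp (α i + α j + ε i j (α i) (α j))

/-- The Bernoulli log-likelihood
`∑_{i < j} X_{ij} log p_{ij} + (1 - X_{ij}) log (1 - p_{ij})`. -/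
def logLik (X : Matrix (Fin n) (Fin n) ℝ) (p : Fin n → Fin n → ℝ) : ℝ :=
  ∑ i, ∑ j ∈ Finset.Ioi i,
    (X i j * Real.log (p i j) + (1 - X i j) * Real.log (1 - p i j))

/-- `ε = {ε_{ij} : i ≠ j}` is a family of smooth functions of two real variables with
`ε_{ij}(x, y) = ε_{ji}(y, x)`. -/
structure IsSmoothFamily (ε : Fin n → Fin n → ℝ → ℝ → ℝ) : Prop where
  smooth : ∀ i j, i ≠ j → ContDiff ℝ ∞ (fun z : ℝ × ℝ => ε i j z.1 z.2)
  symm : ∀ i j, i ≠ j → ∀ x y, ε i j x y = ε j i y x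

/-- The functions `α ↦ ε_{ij}(α_i, α_j)` and all their partial derivatives
`∂^m / ∂α_{k_1} ⋯ ∂α_{k_m}` of order `m ≤ 3` are bounded in absolute value by
`C₀ exp (α_i + α_j)`. -/
def SubExponential (ε : Fin n → Fin n → ℝ → ℝ → ℝ) (C₀ : ℝ) : Prop :=
  ∀ i j, i ≠ j → ∀ m : ℕ, m ≤ 3 → ∀ (k : Fin m → Fin n) (α : Fin n → ℝ),
    |iteratedFDeriv ℝ m (fun a : Fin n → ℝ => ε i j (a i) (a j)) α
        (fun t => Pi.single (k t) (1 : ℝ))|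
      ≤ C₀ * Real.exp (α i + α j)

/-- `α` solves the likelihood equation `∇ℓ(α) = 0`, where `ℓ(α)` is the log-likelihood at the
edge probabilities `p_{ij}(α)`, which are required to be probabilities less than one at `α`,
so that all the logarithms in `ℓ` are logarithms of positive numbers near `α`. -/
def SolvesLikelihoodEq (X : Matrix (Fin n) (Fin n) ℝ) (ε : Fin n → Fin n → ℝ → ℝ → ℝ)
    (α : Fin n → ℝ) : Prop :=
  (∀ i j, i ≠ j → prob ε α i j < 1) ∧
    HasFDerivAt (fun a : Fin n → ℝ => logLik X (prob ε a)) (0 : (Fin n → ℝ) →L[ℝ] ℝ) α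

end NullModel

end

/-! ### Derivatives of the perturbations `ε i j` -/

namespace NullModel

/-! Write P for `pTilde`, d for `deg`, w for the weights d_k / `total X` (which sum to 1), and e for
the sparsity bound. The rows of P sum to the degrees, so at `alphaTilde` the score of node i in the
unperturbed model would vanish up to the diagonal term P_ii, a nonlinear factor 1/(1 - p) and the
perturbation. Each of these is O((C+1) e d_i) (`abs_score_alphaTilde_le`).

On the ball of radius 10(C+1)e, the score divided by d_i has derivative close to -(I + 1wᵀ):
non-edges contribute about -P_ij (u_i + u_j), while an edge term is 1 + ∂ε_ij/∂α_i and hardly moves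
(`abs_scoreTerm_sub_le`, `abs_score_sub_le`). The matrix I + 1wᵀ has the explicit inverse I -
(1/2)1wᵀ, of sup-norm at most 3/2 whatever n is. A Newton iteration with this frozen inverse is
therefore a contraction of the ball into itself, and its fixed point is a zero of the score
(`exists_zero_of_approx_rank_one`).

For the likelihoods, every log p_ij moves by O((C+1)e) on the ball. Summed over pairs, this changes
the log-likelihood by O((C+1)e) times the number of edges (`abs_logLik_sub_le`), whereas each edge
alone contributes at most -1 to the log-likelihood at P (`logLik_pTilde_le`). -/

/-- The partial derivative `∂ε_{ij}/∂α_i`. -/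
noncomputable def epsDeriv {n : ℕ} (ε : Fin n → Fin n → ℝ → ℝ → ℝ) (i j : Fin n)
    (α : Fin n → ℝ) : ℝ :=
  fderiv ℝ (fun a : Fin n → ℝ => ε i j (a i) (a j)) α (Pi.single i 1)

theorem hasFDerivAt_comp_pair {n : ℕ} (i j : Fin n) {E : ℝ × ℝ → ℝ} (hE : Differentiable ℝ E)
    (a : Fin n → ℝ) :
    HasFDerivAt (fun a : Fin n → ℝ => E (a i, a j))
      ((fderiv ℝ E (a i, a j)).comp
        ((ContinuousLinearMap.proj (R := ℝ) (φ := fun _ : Fin n => ℝ) i).prod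
          (ContinuousLinearMap.proj j))) a := by
  have h := (hE (a i, a j)).hasFDerivAt
  exact HasFDerivAt.comp (f := fun a : Fin n → ℝ => (a i, a j)) a h
    ((hasFDerivAt_apply i a).prodMk (hasFDerivAt_apply j a))

/-- Only two coordinates matter, so bounds on partial derivatives give operator bounds in the
sup-norm with a factor 2 instead of n. -/
theorem fderiv_comp_pair_apply {n : ℕ} {i j : Fin n} (hij : i ≠ j) {E : ℝ × ℝ → ℝ}
    (hE : Differentiable ℝ E) (a u : Fin n → ℝ) :
    fderiv ℝ (fun a : Fin n → ℝ => E (a i, a j)) a u =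
      u i * fderiv ℝ (fun a : Fin n → ℝ => E (a i, a j)) a (Pi.single i 1) +
        u j * fderiv ℝ (fun a : Fin n → ℝ => E (a i, a j)) a (Pi.single j 1) := by
  rw [(hasFDerivAt_comp_pair i j hE a).fderiv]
  have : ((u i, u j) : ℝ × ℝ) = u i • ((1 : ℝ), (0 : ℝ)) + u j • ((0 : ℝ), (1 : ℝ)) := by simp
  simp only [ContinuousLinearMap.comp_apply, ContinuousLinearMap.prod_apply,
    ContinuousLinearMap.proj_apply, Pi.single_eq_same, Pi.single_eq_of_ne hij,
    Pi.single_eq_of_ne hij.symm]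
  rw [this, map_add, map_smul, map_smul, smul_eq_mul, smul_eq_mul]

theorem abs_mul_add_mul_le {n : ℕ} (u : Fin n → ℝ) (i j : Fin n) {x y K : ℝ}
    (hx : |x| ≤ K) (hy : |y| ≤ K) : |u i * x + u j * y| ≤ 2 * K * ‖u‖ := by
  have hi : |u i| ≤ ‖u‖ := norm_le_pi_norm u i
  have hj : |u j| ≤ ‖u‖ := norm_le_pi_norm u j
  calc |u i * x + u j * y| ≤ |u i * x| + |u j * y| := abs_add_le _ _
    _ = |u i| * |x| + |u j| * |y| := by rw [abs_mul, abs_mul]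
    _ ≤ ‖u‖ * K + ‖u‖ * K := by gcongr
    _ = _ := by ring

section Bounds

variable {n : ℕ} {ε : Fin n → Fin n → ℝ → ℝ → ℝ} {C : ℝ} {i j : Fin n}

theorem SubExponential.abs_le (hC : SubExponential ε C) (hij : i ≠ j) (a : Fin n → ℝ) :
    |ε i j (a i) (a j)| ≤ C * Real.exp (a i + a j) := by
  simpa using hC i j hij 0 (by norm_num) Fin.elim0 a

theorem SubExponential.abs_fderiv_single_le (hC : SubExponential ε C) (hij : i ≠ j)
    (k : Fin n) (a : Fin n → ℝ) :
    |fderiv ℝ (fun a : Fin n → ℝ => ε i j (a i) (a j)) a (Pi.single k 1)| ≤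
      C * Real.exp (a i + a j) := by
  simpa using hC i j hij 1 (by norm_num) (fun _ => k) a

theorem SubExponential.abs_epsDeriv_le (hC : SubExponential ε C) (hij : i ≠ j)
    (a : Fin n → ℝ) : |epsDeriv ε i j a| ≤ C * Real.exp (a i + a j) :=
  hC.abs_fderiv_single_le hij i a

theorem IsSmoothFamily.differentiable (hε : IsSmoothFamily ε) (hij : i ≠ j) :
    Differentiable ℝ (fun z : ℝ × ℝ => ε i j z.1 z.2) :=
  (hε.smooth i j hij).differentiable (by simp)

theorem IsSmoothFamily.contDiff_pair (hε : IsSmoothFamily ε) (hij : i ≠ j) :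
    ContDiff ℝ ∞ (fun a : Fin n → ℝ => ε i j (a i) (a j)) :=
  (hε.smooth i j hij).comp (f := fun a : Fin n → ℝ => (a i, a j)) (by fun_prop)

theorem IsSmoothFamily.differentiableAt_pair (hε : IsSmoothFamily ε) (hij : i ≠ j)
    (a : Fin n → ℝ) : DifferentiableAt ℝ (fun a : Fin n → ℝ => ε i j (a i) (a j)) a :=
  (hε.contDiff_pair hij).differentiable (by simp) a

theorem IsSmoothFamily.fderiv_apply (hε : IsSmoothFamily ε) (hij : i ≠ j) (a u : Fin n → ℝ) :
    fderiv ℝ (fun a : Fin n → ℝ => ε i j (a i) (a j)) a u =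
      u i * epsDeriv ε i j a + u j * epsDeriv ε j i a := by
  have hs : (fun a : Fin n → ℝ => ε j i (a j) (a i)) = fun a => ε i j (a i) (a j) :=
    funext fun a => hε.symm j i hij.symm _ _
  rw [epsDeriv, epsDeriv, hs]
  exact fderiv_comp_pair_apply hij (hε.differentiable hij) a u

theorem IsSmoothFamily.abs_fderiv_le (hε : IsSmoothFamily ε) (hC : SubExponential ε C)
    (hij : i ≠ j) (a u : Fin n → ℝ) :
    |fderiv ℝ (fun a : Fin n → ℝ => ε i j (a i) (a j)) a u| ≤
      2 * (C * Real.exp (a i + a j)) * ‖u‖ := by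
  rw [hε.fderiv_apply hij]
  refine abs_mul_add_mul_le u i j (hC.abs_epsDeriv_le hij a) ?_
  rw [add_comm (a i)]
  exact hC.abs_epsDeriv_le hij.symm a

theorem IsSmoothFamily.contDiff_epsDeriv (hε : IsSmoothFamily ε) (hij : i ≠ j) :
    ContDiff ℝ 1 (epsDeriv ε i j) :=
  ((hε.contDiff_pair hij).fderiv_right (m := 1) (by norm_cast)).clm_apply contDiff_const

theorem IsSmoothFamily.differentiableAt_epsDeriv (hε : IsSmoothFamily ε) (hij : i ≠ j)
    (a : Fin n → ℝ) : DifferentiableAt ℝ (epsDeriv ε i j) a :=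
  (hε.contDiff_epsDeriv hij).differentiable (by simp) a

theorem IsSmoothFamily.abs_fderiv_epsDeriv_single_le (hε : IsSmoothFamily ε)
    (hC : SubExponential ε C) (hij : i ≠ j) (k : Fin n) (a : Fin n → ℝ) :
    |fderiv ℝ (epsDeriv ε i j) a (Pi.single k 1)| ≤ C * Real.exp (a i + a j) := by
  have h := hC i j hij 2 (by norm_num) ![k, i] a
  rw [iteratedFDeriv_two_apply] at h
  have hd : DifferentiableAt ℝ (fderiv ℝ (fun a : Fin n → ℝ => ε i j (a i) (a j))) a :=
    ((hε.contDiff_pair hij).fderiv_right (m := 1) (by norm_cast)).differentiable (by simp) a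
  have he : HasFDerivAt (epsDeriv ε i j) _ a :=
    hd.hasFDerivAt.clm_apply (hasFDerivAt_const (Pi.single i 1 : Fin n → ℝ) a)
  rw [he.fderiv]
  simpa using h

theorem IsSmoothFamily.abs_fderiv_epsDeriv_le (hε : IsSmoothFamily ε) (hC : SubExponential ε C)
    (hij : i ≠ j) (a u : Fin n → ℝ) :
    |fderiv ℝ (epsDeriv ε i j) a u| ≤ 2 * (C * Real.exp (a i + a j)) * ‖u‖ := by
  -- The partial derivative again depends on `a i` and `a j` alone, so the two-coordinate formula
  -- applies to it as well.
  have he : epsDeriv ε i j = fun a : Fin n → ℝ =>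
      (fun z : ℝ × ℝ => fderiv ℝ (fun z : ℝ × ℝ => ε i j z.1 z.2) z (1, 0)) (a i, a j) := by
    funext a
    have h := (hasFDerivAt_comp_pair i j (hε.differentiable hij) a).fderiv
    simp only at h
    rw [epsDeriv, h]
    simp [Pi.single_eq_of_ne hij.symm]
  have hd : Differentiable ℝ
      (fun z : ℝ × ℝ => fderiv ℝ (fun z : ℝ × ℝ => ε i j z.1 z.2) z (1, 0)) :=
    (((hε.smooth i j hij).fderiv_right (m := 1) (by norm_cast)).clm_apply
      contDiff_const).differentiable (by simp)
  have h2 := fderiv_comp_pair_apply hij hd a u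
  rw [← he] at h2
  rw [h2]
  exact abs_mul_add_mul_le u i j (hε.abs_fderiv_epsDeriv_single_le hC hij i a)
    (hε.abs_fderiv_epsDeriv_single_le hC hij j a)

theorem IsSmoothFamily.prob_comm (hε : IsSmoothFamily ε) (hij : i ≠ j) (a : Fin n → ℝ) :
    prob ε a i j = prob ε a j i := by
  rw [prob, prob, hε.symm i j hij, add_comm (a i)]

end Bounds

/-! ### The score and the gradient of the log-likelihood -/

/-- The contribution `(X_{ij} - p_{ij}) / (1 - p_{ij}) * (1 + ∂ε_{ij}/∂α_i)` of the pair `(i, j)`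
to `∂ℓ/∂α_i`. -/
noncomputable def scoreTerm {n : ℕ} (X : Matrix (Fin n) (Fin n) ℝ)
    (ε : Fin n → Fin n → ℝ → ℝ → ℝ) (i j : Fin n) (α : Fin n → ℝ) : ℝ :=
  (X i j - (1 - X i j) * (prob ε α i j / (1 - prob ε α i j))) * (1 + epsDeriv ε i j α)

/-- The partial derivative `∂ℓ/∂α_i`. -/
noncomputable def score {n : ℕ} (X : Matrix (Fin n) (Fin n) ℝ)
    (ε : Fin n → Fin n → ℝ → ℝ → ℝ) (α : Fin n → ℝ) (i : Fin n) : ℝ :=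
  ∑ j ∈ {i}ᶜ, scoreTerm X ε i j α

section Gradient

variable {n : ℕ} {X : Matrix (Fin n) (Fin n) ℝ} {ε : Fin n → Fin n → ℝ → ℝ → ℝ} {i j : Fin n}

theorem hasFDerivAt_exponent (hε : IsSmoothFamily ε) (hij : i ≠ j) (α : Fin n → ℝ) :
    HasFDerivAt (fun a : Fin n → ℝ => a i + a j + ε i j (a i) (a j))
      (ContinuousLinearMap.proj (R := ℝ) (φ := fun _ : Fin n => ℝ) i +
        ContinuousLinearMap.proj j +
        fderiv ℝ (fun a : Fin n → ℝ => ε i j (a i) (a j)) α) α :=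
  ((hasFDerivAt_apply i α).add (hasFDerivAt_apply j α)).add
    (hε.differentiableAt_pair hij α).hasFDerivAt

theorem hasFDerivAt_logLik_pair (hε : IsSmoothFamily ε) (hij : i ≠ j) {α : Fin n → ℝ}
    (hp : prob ε α i j < 1) :
    ∃ L : (Fin n → ℝ) →L[ℝ] ℝ,
      HasFDerivAt (fun a => X i j * Real.log (prob ε a i j) +
        (1 - X i j) * Real.log (1 - prob ε a i j)) L α ∧
      ∀ u, L u = (X i j - (1 - X i j) * (prob ε α i j / (1 - prob ε α i j))) *
        (u i * (1 + epsDeriv ε i j α) + u j * (1 + epsDeriv ε j i α)) := by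
  have hs := hasFDerivAt_exponent hε hij α
  have hne : 1 - prob ε α i j ≠ 0 := by linarith
  have h := (hs.const_mul (X i j)).add (((hs.exp.const_sub 1).log hne).const_mul (1 - X i j))
  refine ⟨_, h.congr_of_eventuallyEq (Filter.Eventually.of_forall fun a => ?_), ?_⟩
  · simp only [prob, Real.log_exp, Pi.add_apply]
  · intro u
    simp only [add_apply, smul_apply,
      neg_apply, ContinuousLinearMap.proj_apply, hε.fderiv_apply hij,
      smul_eq_mul]
    change _ + (1 - X i j) * ((1 - prob ε α i j)⁻¹ * -(prob ε α i j * _)) = _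
    ring

/-- By symmetry the sum over pairs i < j regroups by node, and the derivative along u becomes the
pairing of u with the score. -/
theorem hasFDerivAt_logLik (hX : X.IsSymm) (hε : IsSmoothFamily ε) {α : Fin n → ℝ}
    (hp : ∀ i j, i ≠ j → prob ε α i j < 1) (hs : ∀ i, score X ε α i = 0) :
    HasFDerivAt (fun a : Fin n → ℝ => logLik X (prob ε a)) (0 : (Fin n → ℝ) →L[ℝ] ℝ) α := by
  have h : ∀ i j, ∃ L : (Fin n → ℝ) →L[ℝ] ℝ, i ≠ j →
      HasFDerivAt (fun a => X i j * Real.log (prob ε a i j) +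
        (1 - X i j) * Real.log (1 - prob ε a i j)) L α ∧
      ∀ u, L u = u i * scoreTerm X ε i j α + u j * scoreTerm X ε j i α := by
    intro i j
    by_cases hij : i = j
    · exact ⟨0, fun h => (h hij).elim⟩
    · obtain ⟨L, h1, h2⟩ := hasFDerivAt_logLik_pair (X := X) hε hij (hp i j hij)
      refine ⟨L, fun _ => ⟨h1, fun u => ?_⟩⟩
      rw [h2, scoreTerm, scoreTerm, hX.apply i j, hε.prob_comm (Ne.symm hij)]
      ring
  choose L hL using h
  have hne : ∀ i j : Fin n, j ∈ Finset.Ioi i → i ≠ j := fun i j hj =>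
    (Finset.mem_Ioi.1 hj).ne
  have hsum : HasFDerivAt (fun a : Fin n → ℝ => logLik X (prob ε a))
      (∑ i, ∑ j ∈ Finset.Ioi i, L i j) α := by
    unfold logLik
    exact HasFDerivAt.fun_sum fun i _ => HasFDerivAt.fun_sum fun j hj => (hL i j (hne i j hj)).1
  convert hsum
  ext1 u
  simp only [zero_apply, sum_apply]
  symm
  calc ∑ i, ∑ j ∈ Finset.Ioi i, L i j u
      = ∑ i, ∑ j ∈ Finset.Ioi i, (u i * scoreTerm X ε i j α + u j * scoreTerm X ε j i α) :=
        Finset.sum_congr rfl fun i _ => Finset.sum_congr rfl fun j hj =>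
          (hL i j (hne i j hj)).2 u
    _ = ∑ i, ∑ j ∈ {i}ᶜ, u i * scoreTerm X ε i j α :=
        Finset.sum_sum_Ioi_add_eq_sum_sum_off_diag fun j i => u i * scoreTerm X ε i j α
    _ = 0 := Finset.sum_eq_zero fun i _ => by
        rw [← Finset.mul_sum]
        exact mul_eq_zero_of_right _ (hs i)

end Gradient

/-! ### Scalar estimates -/

/-- If `|s| ≤ x ≤ 1/11`, then `exp s` differs from `1` by at most `(11/10) x`. -/
theorem abs_exp_sub_one_le_of_abs_le {s x : ℝ} (hs : |s| ≤ x) (hx : x ≤ 1 / 11) :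
    |Real.exp s - 1| ≤ 1.1 * x := by
  obtain ⟨h1, h2⟩ := abs_le.1 hs
  have hx0 : 0 ≤ x := (abs_nonneg s).trans hs
  rw [abs_le]
  constructor
  · have := Real.add_one_le_exp s
    linarith
  · have h3 : Real.exp x ≤ 1 / (1 - x) :=
      Real.exp_bound_div_one_sub_of_interval hx0 (by linarith)
    -- Equivalent to 1.1 x² ≤ 0.1 x, which is where the threshold 1/11 comes from.
    have h4 : 1 / (1 - x) ≤ 1 + 1.1 * x := by
      rw [div_le_iff₀ (by linarith)]
      nlinarith
    have h5 := Real.exp_le_exp.2 h2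
    linarith

/-- A sharper form of `abs_exp_sub_one_le_of_abs_le` for smaller arguments. -/
theorem abs_exp_sub_one_le_of_abs_le' {s x : ℝ} (hs : |s| ≤ x) (hx : x ≤ 1 / 900) :
    |Real.exp s - 1| ≤ 1.01 * x := by
  obtain ⟨h1, h2⟩ := abs_le.1 hs
  have hx0 : 0 ≤ x := (abs_nonneg s).trans hs
  rw [abs_le]
  constructor
  · have := Real.add_one_le_exp s
    linarith
  · have h3 : Real.exp x ≤ 1 / (1 - x) :=
      Real.exp_bound_div_one_sub_of_interval hx0 (by linarith)
    have h4 : 1 / (1 - x) ≤ 1 + 1.01 * x := by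
      rw [div_le_iff₀ (by linarith)]
      nlinarith
    have h5 := Real.exp_le_exp.2 h2
    linarith

/-- To first order the relative errors add: x from p, x from 1 + s, and e from 1/(1 - p). The factor
1.05 absorbs the rest. It is applied with x = C e. -/
theorem odds_mul_sub_le {P p x s e : ℝ} (hP : 0 < P) (hPe : P ≤ e) (he : e ≤ 1 / 225)
    (hx : x ≤ 1 / 900) (hp : |p - P| ≤ 1.01 * x * P) (hs : |s| ≤ x) :
    |p / (1 - p) * (1 + s) - P| ≤ 1.05 * (2 * x + e) * P := by
  have hx0 : 0 ≤ x := (abs_nonneg s).trans hs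
  obtain ⟨hp1, hp2⟩ := abs_le.1 hp
  obtain ⟨hs1, hs2⟩ := abs_le.1 hs
  have hxP : x * P ≤ 1 / 900 * P := by gcongr
  have hxP0 : 0 ≤ x * P := by positivity
  have hp0 : 0 < p := by nlinarith
  have hpe : p ≤ 1.01 * e := by nlinarith
  have hp1' : 0 < 1 - p := by linarith
  set q := p / (1 - p) with hq
  have hqp : p ≤ q := by
    rw [hq, le_div_iff₀ hp1']
    nlinarith
  have hqp2 : q ≤ p * (1 + 1.02 * e) := by
    rw [hq, div_le_iff₀ hp1']
    have : 0 ≤ p * ((1 + 1.02 * e) * (1 - p) - 1) := by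
      apply mul_nonneg hp0.le
      nlinarith
    nlinarith
  have he0 : 0 < e := hP.trans_le hPe
  rw [abs_le]
  constructor
  · have h1 : P * (1 - 1.01 * x) * (1 - x) ≤ q * (1 + s) := by
      apply mul_le_mul _ (by linarith) (by linarith) (by linarith)
      linarith
    nlinarith [mul_nonneg hxP0 hx0, mul_pos hP he0]
  · have h1 : q * (1 + s) ≤ P * (1 + 1.01 * x) * (1 + 1.02 * e) * (1 + x) := by
      apply mul_le_mul _ (by linarith) (by linarith) (by positivity)
      refine hqp2.trans ?_
      gcongr
      linarith
    have h2 : (1 + 1.01 * x) * (1 + 1.02 * e) * (1 + x) ≤ 1 + 1.05 * (2 * x + e) := by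
      have h3 : (1 + 1.01 * x) * (1 + x) ≤ 1 + 2.02 * x := by nlinarith
      have h4 : (1 + 2.02 * x) * (1 + 1.02 * e) ≤ 1 + 1.05 * (2 * x + e) := by
        nlinarith [mul_nonneg hx0 he0.le]
      have h5 := mul_le_mul_of_nonneg_right h3 (show 0 ≤ 1 + 1.02 * e by positivity)
      linarith
    have h3 := mul_le_mul_of_nonneg_left h2 hP.le
    linarith

/-- The derivative of `p / (1 - p) * (1 + s)`, with `v` the derivative of `α_i + α_j`, is close
to `P v`, where `P` is the degree-based edge probability. -/
theorem abs_deriv_odds_mul_sub_le {P p s v g h U : ℝ} (hP : 0 < P) (hP2 : P ≤ 1 / 225)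
    (hp1 : 0.909 * P ≤ p) (hp2 : p ≤ 1.1 * P) (hs : |s| ≤ 1 / 800)
    (hv : |v| ≤ 2 * U) (hg : |g| ≤ 1 / 400 * U) (hh : |h| ≤ 1 / 400 * U) :
    |p / (1 - p) ^ 2 * (v + g) * (1 + s) + p / (1 - p) * h - P * v| ≤ 1 / 4 * P * U := by
  obtain ⟨hs1, hs2⟩ := abs_le.1 hs
  have hU : 0 ≤ U := by linarith [abs_nonneg v]
  have hp0 : 0 < p := by linarith
  have hp1' : 0 < 1 - p := by linarith
  have ho : p / (1 - p) ≤ 1.11 * P := by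
    rw [div_le_iff₀ hp1']
    nlinarith
  have ho0 : 0 ≤ p / (1 - p) := by positivity
  have hk1 : p ≤ p / (1 - p) ^ 2 := by
    rw [le_div_iff₀ (by positivity)]
    have : (1 - p) ^ 2 ≤ 1 := by nlinarith
    nlinarith
  have hk2 : p / (1 - p) ^ 2 ≤ 1.112 * P := by
    rw [div_le_iff₀ (by positivity)]
    have : 0.99 ≤ (1 - p) ^ 2 := by nlinarith
    nlinarith
  set k := p / (1 - p) ^ 2 * (1 + s) with hk
  have hk3 : k ≤ 1.114 * P := by
    have : k ≤ 1.112 * P * (1 + 1 / 800) := by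
      apply mul_le_mul hk2 (by linarith) (by linarith) (by positivity)
    linarith
  have hk4 : 0.907 * P ≤ k := by
    have : 0.909 * P * (1 - 1 / 800) ≤ k := by
      apply mul_le_mul (by linarith) (by linarith) (by norm_num) (by positivity)
    linarith
  have hk5 : |k - P| ≤ 0.114 * P := by
    rw [abs_le]
    constructor <;> linarith
  have hk6 : |k| ≤ 1.114 * P := by
    rw [abs_of_nonneg (by linarith)]
    exact hk3
  have ho' : |p / (1 - p)| ≤ 1.11 * P := by
    rwa [abs_of_nonneg ho0]
  have e : p / (1 - p) ^ 2 * (v + g) * (1 + s) + p / (1 - p) * h - P * v =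
      (k - P) * v + k * g + p / (1 - p) * h := by
    rw [hk]
    ring
  rw [e]
  calc |(k - P) * v + k * g + p / (1 - p) * h|
      ≤ |(k - P) * v| + |k * g| + |p / (1 - p) * h| := abs_add_three _ _ _
    _ = |k - P| * |v| + |k| * |g| + |p / (1 - p)| * |h| := by simp only [abs_mul]
    _ ≤ (0.114 * P) * (2 * U) + 1.114 * P * (1 / 400 * U) + 1.11 * P * (1 / 400 * U) := by
        gcongr
    _ ≤ 1 / 4 * P * U := by nlinarith [mul_nonneg hP.le hU]

/-! ### The sparse regime and the degree-based estimate -/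

/-- The hypotheses on the graph and on the model under which the likelihood equation is
solved near the degree-based estimate. -/
structure SparseRegime {n : ℕ} (X : Matrix (Fin n) (Fin n) ℝ)
    (ε : Fin n → Fin n → ℝ → ℝ → ℝ) (C e : ℝ) : Prop where
  adj : X.IsAdjMatrix
  smooth : IsSmoothFamily ε
  subExp : SubExponential ε C
  deg_sq : ∀ i, 1 ≤ deg X i ^ 2 ∧ deg X i ^ 2 ≤ e * total X
  small : e ≤ ((15 * (C + 1)) ^ 2)⁻¹

namespace SparseRegime

variable {n : ℕ} {X : Matrix (Fin n) (Fin n) ℝ} {ε : Fin n → Fin n → ℝ → ℝ → ℝ} {C e : ℝ}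

theorem entry_nonneg (h : SparseRegime X ε C e) (i j : Fin n) : 0 ≤ X i j := by
  rcases h.adj.zero_or_one i j with hx | hx <;> simp [hx]

theorem entry_le_one (h : SparseRegime X ε C e) (i j : Fin n) : X i j ≤ 1 := by
  rcases h.adj.zero_or_one i j with hx | hx <;> simp [hx]

theorem one_le_deg (h : SparseRegime X ε C e) (i : Fin n) : 1 ≤ deg X i := by
  have h0 : 0 ≤ deg X i := Finset.sum_nonneg fun j _ => h.entry_nonneg i j
  nlinarith [(h.deg_sq i).1]

theorem deg_pos (h : SparseRegime X ε C e) (i : Fin n) : 0 < deg X i :=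
  zero_lt_one.trans_le (h.one_le_deg i)

theorem total_pos (h : SparseRegime X ε C e) (i : Fin n) : 0 < total X :=
  Finset.sum_pos (fun j _ => h.deg_pos j) ⟨i, Finset.mem_univ i⟩

theorem e_pos (h : SparseRegime X ε C e) (i : Fin n) : 0 < e := by
  have h1 : 0 < e * total X := by linarith [(h.deg_sq i).1, (h.deg_sq i).2]
  exact pos_of_mul_pos_left h1 (h.total_pos i).le

theorem C_nonneg (h : SparseRegime X ε C e) (i : Fin n) : 0 ≤ C := by
  -- The bound on `ε i j` has content only if a second node exists; a lone node would have degree 0.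
  have : ∃ j, i ≠ j := by
    by_contra! hc
    have h0 : deg X i = 0 := Finset.sum_eq_zero fun j _ => by rw [← hc j, h.adj.apply_diag]
    linarith [h.deg_pos i]
  obtain ⟨j, hij⟩ := this
  have h1 := (abs_nonneg _).trans (h.subExp.abs_le hij 0)
  exact nonneg_of_mul_nonneg_left h1 (Real.exp_pos _)

theorem mul_sq_le (h : SparseRegime X ε C e) (i : Fin n) : e * (C + 1) ^ 2 ≤ 1 / 225 := by
  have hC := h.C_nonneg i
  have h1 := h.small
  rw [mul_pow, mul_inv, ← div_eq_mul_inv, le_div_iff₀ (by positivity)] at h1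
  norm_num at h1 ⊢
  exact h1

/-- From 4C ≤ (C + 1)². -/
theorem C_mul_e_le (h : SparseRegime X ε C e) (i : Fin n) : C * e ≤ 1 / 900 := by
  nlinarith [h.mul_sq_le i, mul_nonneg (h.e_pos i).le (sq_nonneg (C - 1))]

theorem mul_e_le (h : SparseRegime X ε C e) (i : Fin n) : (C + 1) * e ≤ 1 / 225 := by
  nlinarith [h.mul_sq_le i, mul_nonneg (h.e_pos i).le
    (mul_nonneg (h.C_nonneg i) (add_nonneg (h.C_nonneg i) zero_le_one))]

theorem e_le (h : SparseRegime X ε C e) (i : Fin n) : e ≤ 1 / 225 := by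
  nlinarith [h.mul_e_le i, mul_nonneg (h.C_nonneg i) (h.e_pos i).le]

theorem pTilde_pos (h : SparseRegime X ε C e) (i j : Fin n) : 0 < pTilde X i j :=
  div_pos (mul_pos (h.deg_pos i) (h.deg_pos j)) (h.total_pos i)

theorem pTilde_le (h : SparseRegime X ε C e) (i j : Fin n) : pTilde X i j ≤ e := by
  rw [pTilde, div_le_iff₀ (h.total_pos i)]
  nlinarith [(h.deg_sq i).2, (h.deg_sq j).2, sq_nonneg (deg X i - deg X j)]

theorem C_mul_pTilde_le (h : SparseRegime X ε C e) (i j : Fin n) :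
    C * pTilde X i j ≤ C * e :=
  mul_le_mul_of_nonneg_left (h.pTilde_le i j) (h.C_nonneg i)

theorem sum_pTilde (h : SparseRegime X ε C e) (i : Fin n) : ∑ j, pTilde X i j = deg X i := by
  have : ∑ j, deg X j = total X := rfl
  simp only [pTilde]
  rw [← Finset.sum_div, ← Finset.mul_sum, this, mul_div_cancel_right₀ _ (h.total_pos i).ne']

theorem exp_alphaTilde (h : SparseRegime X ε C e) (i j : Fin n) :
    Real.exp (alphaTilde X i + alphaTilde X j) = pTilde X i j := by
  have hs := Real.sqrt_pos.2 (h.total_pos i)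
  simp only [alphaTilde]
  rw [Real.exp_add, Real.exp_sub, Real.exp_sub, Real.exp_log (h.deg_pos i),
    Real.exp_log (h.deg_pos j), Real.exp_log hs, div_mul_div_comm,
    Real.mul_self_sqrt (h.total_pos i).le, pTilde]

theorem log_pTilde (h : SparseRegime X ε C e) (i j : Fin n) :
    Real.log (pTilde X i j) = alphaTilde X i + alphaTilde X j := by
  rw [← h.exp_alphaTilde, Real.log_exp]

/-! ### Edge probabilities on the ball around `alphaTilde X` -/

section Ball

variable {α : Fin n → ℝ} {i j : Fin n}

theorem abs_exponent_sub_le (hα : ‖α - alphaTilde X‖ ≤ 10 * (C + 1) * e) :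
    |α i + α j - (alphaTilde X i + alphaTilde X j)| ≤ 20 * (C + 1) * e := by
  have hi : |α i - alphaTilde X i| ≤ _ := (norm_le_pi_norm (α - alphaTilde X) i).trans hα
  have hj : |α j - alphaTilde X j| ≤ _ := (norm_le_pi_norm (α - alphaTilde X) j).trans hα
  rw [abs_le] at hi hj ⊢
  constructor <;> linarith [hi.1, hi.2, hj.1, hj.2]

theorem exp_exponent_le (h : SparseRegime X ε C e)
    (hα : ‖α - alphaTilde X‖ ≤ 10 * (C + 1) * e) :
    Real.exp (α i + α j) ≤ 1.1 * pTilde X i j := by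
  have h1 := abs_exponent_sub_le (i := i) (j := j) hα
  have h2 := h.mul_e_le i
  have h3 := (abs_le.1 (abs_exp_sub_one_le_of_abs_le h1 (by linarith))).2
  have h4 : Real.exp (α i + α j) = pTilde X i j *
      Real.exp (α i + α j - (alphaTilde X i + alphaTilde X j)) := by
    rw [← h.exp_alphaTilde, ← Real.exp_add]
    ring_nf
  rw [h4]
  nlinarith [h.pTilde_pos i j]

theorem C_mul_exp_le (h : SparseRegime X ε C e)
    (hα : ‖α - alphaTilde X‖ ≤ 10 * (C + 1) * e) :
    C * Real.exp (α i + α j) ≤ 1.1 * (C * e) := by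
  have h1 := mul_le_mul_of_nonneg_left (h.exp_exponent_le (i := i) (j := j) hα) (h.C_nonneg i)
  linarith [h.C_mul_pTilde_le i j]

/-- The deviation of `log p_{ij}(α)` from `log p̃_{ij}`. -/
theorem abs_log_prob_sub_le (h : SparseRegime X ε C e) (hij : i ≠ j)
    (hα : ‖α - alphaTilde X‖ ≤ 10 * (C + 1) * e) :
    |α i + α j + ε i j (α i) (α j) - (alphaTilde X i + alphaTilde X j)| ≤
      20 * (C + 1) * e + 1.1 * (C * e) := by
  have h1 := abs_exponent_sub_le (i := i) (j := j) hα
  have h2 := (h.subExp.abs_le hij α).trans (h.C_mul_exp_le hα)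
  rw [abs_le] at h1 h2 ⊢
  constructor <;> linarith [h1.1, h1.2, h2.1, h2.2]

theorem prob_eq (h : SparseRegime X ε C e) :
    prob ε α i j = pTilde X i j *
      Real.exp (α i + α j + ε i j (α i) (α j) - (alphaTilde X i + alphaTilde X j)) := by
  rw [← h.exp_alphaTilde, ← Real.exp_add, prob]
  ring_nf

theorem abs_prob_sub_le (h : SparseRegime X ε C e) (hij : i ≠ j)
    (hα : ‖α - alphaTilde X‖ ≤ 10 * (C + 1) * e) :
    |prob ε α i j - pTilde X i j| ≤
      1.1 * (20 * (C + 1) * e + 1.1 * (C * e)) * pTilde X i j := by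
  have h1 := h.abs_log_prob_sub_le hij hα
  have h2 := h.mul_e_le i
  have h3 := h.C_mul_e_le i
  -- The exponent is at most 20/225 + 1.1/900, just below the threshold 1/11.
  have h4 := abs_exp_sub_one_le_of_abs_le h1 (by linarith)
  have hP := h.pTilde_pos i j
  rw [h.prob_eq, ← mul_sub_one, abs_mul, abs_of_pos hP, mul_comm]
  exact mul_le_mul_of_nonneg_right h4 hP.le

theorem prob_le (h : SparseRegime X ε C e) (hij : i ≠ j)
    (hα : ‖α - alphaTilde X‖ ≤ 10 * (C + 1) * e) : prob ε α i j ≤ 1.1 * pTilde X i j := by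
  have h1 := (abs_le.1 (h.abs_prob_sub_le hij hα)).2
  have h2 := h.mul_e_le i
  have h3 := h.C_mul_e_le i
  nlinarith [h.pTilde_pos i j]

theorem le_prob (h : SparseRegime X ε C e) (hij : i ≠ j)
    (hα : ‖α - alphaTilde X‖ ≤ 10 * (C + 1) * e) : 0.909 * pTilde X i j ≤ prob ε α i j := by
  have h1 := (abs_le.1 (h.abs_log_prob_sub_le hij hα)).1
  have h2 := h.mul_e_le i
  have h3 := h.C_mul_e_le i
  have h4 := Real.add_one_le_exp
    (α i + α j + ε i j (α i) (α j) - (alphaTilde X i + alphaTilde X j))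
  rw [h.prob_eq]
  nlinarith [h.pTilde_pos i j]

theorem prob_lt_one (h : SparseRegime X ε C e) (hij : i ≠ j)
    (hα : ‖α - alphaTilde X‖ ≤ 10 * (C + 1) * e) : prob ε α i j < 1 := by
  linarith [h.prob_le hij hα, h.pTilde_le i j, h.e_le i]

end Ball

/-! ### Single score terms: value at the centre and variation on the ball -/

/-- An edge term is 1 + ∂ε_ij/∂α_i, compared with 1 - P_ij; a non-edge term is minus the perturbed
odds, compared with -P_ij. -/
theorem abs_scoreTerm_alphaTilde_sub_le (h : SparseRegime X ε C e) {i j : Fin n}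
    (hij : i ≠ j) :
    |scoreTerm X ε i j (alphaTilde X) - (X i j - pTilde X i j)| ≤
      (C + 1) * e * X i j + 1.05 * (2 * (C * e) + e) * pTilde X i j := by
  have hP := h.pTilde_pos i j
  have hPe := h.pTilde_le i j
  have hs : |epsDeriv ε i j (alphaTilde X)| ≤ C * e := by
    refine (h.subExp.abs_epsDeriv_le hij _).trans ?_
    rw [h.exp_alphaTilde]
    exact h.C_mul_pTilde_le i j
  have hCe : 0 ≤ C * e := mul_nonneg (h.C_nonneg i) (h.e_pos i).le
  rcases h.adj.zero_or_one i j with hx | hx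
  · have hp : |prob ε (alphaTilde X) i j - pTilde X i j| ≤ 1.01 * (C * e) * pTilde X i j := by
      have h1 := h.subExp.abs_le hij (alphaTilde X)
      rw [h.exp_alphaTilde] at h1
      have h2 := abs_exp_sub_one_le_of_abs_le' (h1.trans (h.C_mul_pTilde_le i j))
        (h.C_mul_e_le i)
      rw [h.prob_eq, ← mul_sub_one, abs_mul, abs_of_pos hP, mul_comm, add_sub_cancel_left]
      exact mul_le_mul_of_nonneg_right h2 hP.le
    have h3 := odds_mul_sub_le hP hPe (h.e_le i) (h.C_mul_e_le i) hp hs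
    rw [scoreTerm, hx, ← abs_neg]
    convert h3 using 2 <;> ring
  · rw [scoreTerm, hx]
    have : 0 ≤ 1.05 * (2 * (C * e) + e) * pTilde X i j :=
      mul_nonneg (by linarith [h.e_pos i]) hP.le
    rw [abs_le] at hs ⊢
    constructor <;> linarith [hs.1, hs.2]

/-- The score terms vary on the ball as if `p_{ij}` were replaced by `p̃_{ij}` in their
derivatives. -/
theorem abs_scoreTerm_sub_le (h : SparseRegime X ε C e) {i j : Fin n} (hij : i ≠ j)
    {α β : Fin n → ℝ} (hα : ‖α - alphaTilde X‖ ≤ 10 * (C + 1) * e)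
    (hβ : ‖β - alphaTilde X‖ ≤ 10 * (C + 1) * e) :
    |scoreTerm X ε i j α - scoreTerm X ε i j β +
        pTilde X i j * ((α - β) i + (α - β) j)| ≤
      (0.012 * X i j + 1 / 4 * pTilde X i j) * ‖α - β‖ := by
  set P := pTilde X i j with hPdef
  have hP : 0 < P := h.pTilde_pos i j
  have hP2 : P ≤ 1 / 225 := (h.pTilde_le i j).trans (h.e_le i)
  set s := Metric.closedBall (alphaTilde X) (10 * (C + 1) * e) with hs
  have hmem : ∀ a, a ∈ s ↔ ‖a - alphaTilde X‖ ≤ 10 * (C + 1) * e := fun a => by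
    rw [hs, mem_closedBall_iff_norm]
  have hK : 0 ≤ 0.012 * X i j + 1 / 4 * P := by linarith [h.entry_nonneg i j]
  have hv : ∀ u : Fin n → ℝ, |u i + u j| ≤ 2 * ‖u‖ := fun u => by
    have := abs_mul_add_mul_le u i j (x := 1) (y := 1) (K := 1) (by simp) (by simp)
    simpa using this
  have hCB : ∀ a ∈ s, C * Real.exp (a i + a j) ≤ 1 / 800 := fun a ha => by
    linarith [h.C_mul_exp_le (i := i) (j := j) ((hmem a).1 ha), h.C_mul_e_le i]
  have hD : ∀ a ∈ s, ∀ u, |fderiv ℝ (epsDeriv ε i j) a u| ≤ 1 / 400 * ‖u‖ := fun a ha u => by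
    refine (h.smooth.abs_fderiv_epsDeriv_le h.subExp hij a u).trans ?_
    gcongr
    linarith [hCB a ha]
  have hE : ∀ a ∈ s, ∀ u, |fderiv ℝ (fun a : Fin n → ℝ => ε i j (a i) (a j)) a u| ≤
      1 / 400 * ‖u‖ := fun a ha u => by
    refine (h.smooth.abs_fderiv_le h.subExp hij a u).trans ?_
    gcongr
    linarith [hCB a ha]
  have hlin : ∀ a, HasFDerivAt (fun a : Fin n → ℝ => P * (a i + a j)) _ a := fun a =>
    ((hasFDerivAt_apply i a).add (hasFDerivAt_apply (𝕜 := ℝ) j a)).const_mul P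
  have key : ∀ a ∈ s, ∃ L : (Fin n → ℝ) →L[ℝ] ℝ,
      HasFDerivAt (fun a => scoreTerm X ε i j a + P * (a i + a j)) L a ∧
      ‖L‖ ≤ 0.012 * X i j + 1 / 4 * P := by
    intro a ha
    have hd := (h.smooth.differentiableAt_epsDeriv hij a).hasFDerivAt.const_add 1
    rcases h.adj.zero_or_one i j with hx | hx
    · have hp1 := h.prob_lt_one hij ((hmem a).1 ha)
      have ho : HasDerivAt (fun x => Real.exp x / (1 - Real.exp x))
          (prob ε a i j / (1 - prob ε a i j) ^ 2) (a i + a j + ε i j (a i) (a j)) := by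
        have hne : 1 - Real.exp (a i + a j + ε i j (a i) (a j)) ≠ 0 := (sub_pos.2 hp1).ne'
        refine ((Real.hasDerivAt_exp _).div ((Real.hasDerivAt_exp _).const_sub 1) hne).congr_deriv ?_
        rw [prob]
        ring
      have ho2 := ho.comp_hasFDerivAt a (hasFDerivAt_exponent h.smooth hij a)
      have hm := ((ho2.mul hd).neg).add (hlin a)
      refine ⟨_, hm.congr_of_eventuallyEq (Filter.Eventually.of_forall fun b => ?_), ?_⟩
      · simp only [scoreTerm, hx, prob, Pi.add_apply, Pi.neg_apply, Pi.mul_apply,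
          Function.comp_apply]
        ring
      · refine ContinuousLinearMap.opNorm_le_bound _ hK fun u => ?_
        have hb := abs_deriv_odds_mul_sub_le hP hP2 (h.le_prob hij ((hmem a).1 ha))
          (h.prob_le hij ((hmem a).1 ha))
          ((h.subExp.abs_epsDeriv_le hij a).trans (hCB a ha)) (hv u) (hE a ha u) (hD a ha u)
        rw [hx, Real.norm_eq_abs, ← abs_neg]
        have e1 : (0.012 * 0 + 1 / 4 * P) * ‖u‖ = 1 / 4 * P * ‖u‖ := by ring
        rw [e1]
        refine le_of_eq_of_le (congrArg _ ?_) hb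
        simp only [add_apply, smul_apply, neg_apply, ContinuousLinearMap.proj_apply,
          smul_eq_mul, Function.comp_apply]
        change -(-(prob ε a i j / (1 - prob ε a i j) * _ + _) + _) = _
        ring
    · have hm := hd.add (hlin a)
      refine ⟨_, hm.congr_of_eventuallyEq (Filter.Eventually.of_forall fun b => ?_), ?_⟩
      · simp only [scoreTerm, hx, Pi.add_apply]
        ring
      · refine ContinuousLinearMap.opNorm_le_bound _ hK fun u => ?_
        rw [hx, Real.norm_eq_abs]
        simp only [add_apply, smul_apply, ContinuousLinearMap.proj_apply, smul_eq_mul]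
        have h1 : |P * (u i + u j)| ≤ 1 / 225 * (2 * ‖u‖) := by
          rw [abs_mul, abs_of_pos hP]
          gcongr
          exact hv u
        have h2 := hD a ha u
        have h3 := mul_nonneg hP.le (norm_nonneg u)
        refine (abs_add_le _ _).trans ?_
        -- Here 2/225 + 1/400 < 0.012.
        nlinarith [norm_nonneg u]
  choose! L hL hLn using key
  have hmv := (convex_closedBall (alphaTilde X)
    (10 * (C + 1) * e)).norm_image_sub_le_of_norm_hasFDerivWithin_le
    (fun a ha => (hL a ha).hasFDerivWithinAt) hLn ((hmem β).2 hβ) ((hmem α).2 hα)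
  refine le_of_eq_of_le (congrArg _ ?_) hmv
  simp only [Pi.sub_apply]
  ring

end SparseRegime

/-! ### Zeros of maps with nearly rank-one-perturbed derivative -/

theorem abs_sum_weights_mul_le {ι : Type*} [Fintype ι] {w r : ι → ℝ} {R : ℝ}
    (hw : ∀ i, 0 ≤ w i) (hw1 : ∑ i, w i = 1) (hr : ∀ i, |r i| ≤ R) : |∑ i, w i * r i| ≤ R :=
  calc |∑ i, w i * r i| ≤ ∑ i, |w i * r i| := Finset.abs_sum_le_sum_abs _ _
    _ ≤ ∑ i, w i * R := Finset.sum_le_sum fun i _ => by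
        rw [abs_mul, abs_of_nonneg (hw i)]
        exact mul_le_mul_of_nonneg_left (hr i) (hw i)
    _ = R := by rw [← Finset.sum_mul, hw1, one_mul]

/-- The inverse `I - (1/2) 1 wᵀ` of `I + 1 wᵀ` has sup-norm at most `3/2`. -/
theorem abs_sub_half_sum_le {ι : Type*} [Fintype ι] {w r : ι → ℝ} {R : ℝ}
    (hw : ∀ i, 0 ≤ w i) (hw1 : ∑ i, w i = 1) (hr : ∀ i, |r i| ≤ R) (i : ι) :
    |r i - 1 / 2 * ∑ k, w k * r k| ≤ 3 / 2 * R := by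
  have h1 := abs_sum_weights_mul_le hw hw1 hr
  have h2 := hr i
  rw [abs_le] at h1 h2 ⊢
  constructor <;> linarith [h1.1, h1.2, h2.1, h2.2]

/-- A map whose derivative is close to `-(I + 1 wᵀ)` on a ball, and which is small at its
centre, has a zero in the ball. -/
theorem exists_zero_of_approx_rank_one {ι : Type*} [Fintype ι] {w : ι → ℝ}
    (hw : ∀ i, 0 ≤ w i) (hw1 : ∑ i, w i = 1) {r : (ι → ℝ) → ι → ℝ} {x₀ : ι → ℝ} {δ : ℝ}
    (hδ : 0 ≤ δ)
    (hlip : ∀ a b, ‖a - x₀‖ ≤ δ → ‖b - x₀‖ ≤ δ → ∀ i,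
      |r a i - r b i + ((a - b) i + ∑ k, w k * (a - b) k)| ≤ 1 / 3 * ‖a - b‖)
    (hres : ∀ i, |r x₀ i| ≤ 1 / 3 * δ) :
    ∃ a, ‖a - x₀‖ ≤ δ ∧ r a = 0 := by
  -- Newton map with the inverse derivative frozen at -(I - (1/2)1wᵀ). Its Lipschitz constant is
  -- (3/2)(1/3) = 1/2, and it moves the centre by at most δ/2, so it preserves the ball.
  set G : (ι → ℝ) → ι → ℝ := fun a i => a i + (r a i - 1 / 2 * ∑ k, w k * r a k) with hG
  have hGlip : ∀ a b, ‖a - x₀‖ ≤ δ → ‖b - x₀‖ ≤ δ → ‖G a - G b‖ ≤ 1 / 2 * ‖a - b‖ := by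
    intro a b ha hb
    refine (pi_norm_le_iff_of_nonneg (by positivity)).2 fun i => ?_
    have h := abs_sub_half_sum_le hw hw1 (hlip a b ha hb) i
    rw [Real.norm_eq_abs]
    refine (le_of_eq_of_le (congrArg _ ?_) h).trans_eq (by ring)
    have e1 : ∑ k, w k * (r a k - r b k + ((a - b) k + ∑ l, w l * (a - b) l)) =
        ∑ k, w k * r a k - ∑ k, w k * r b k + 2 * ∑ k, w k * (a - b) k := by
      simp only [mul_add, mul_sub, Finset.sum_add_distrib, Finset.sum_sub_distrib]
      rw [← Finset.sum_mul, hw1]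
      ring
    rw [e1]
    simp only [hG, Pi.sub_apply]
    ring
  set s := Metric.closedBall x₀ δ with hs
  have hmem : ∀ a, a ∈ s ↔ ‖a - x₀‖ ≤ δ := fun a => by rw [hs, mem_closedBall_iff_norm]
  have hx₀ : ‖x₀ - x₀‖ ≤ δ := by simpa using hδ
  have hG₀ : ‖G x₀ - x₀‖ ≤ 1 / 2 * δ := by
    refine (pi_norm_le_iff_of_nonneg (by positivity)).2 fun i => ?_
    have h := abs_sub_half_sum_le hw hw1 hres i
    rw [Real.norm_eq_abs]
    refine (le_of_eq_of_le (congrArg _ ?_) h).trans_eq (by ring)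
    simp [hG]
  have hmaps : Set.MapsTo G s s := by
    intro a ha
    rw [hmem] at ha ⊢
    have h1 := hGlip a x₀ ha hx₀
    have h2 := norm_sub_le_norm_sub_add_norm_sub (G a) (G x₀) x₀
    linarith
  have hcontr : ContractingWith (1 / 2) (hmaps.restrict G s s) := by
    refine ⟨by
      rw [← NNReal.coe_lt_coe]
      norm_num, LipschitzWith.of_dist_le_mul fun a b => ?_⟩
    have h1 := hGlip a b ((hmem _).1 a.2) ((hmem _).1 b.2)
    rw [Subtype.dist_eq, Subtype.dist_eq, dist_eq_norm, dist_eq_norm]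
    simpa using h1
  obtain ⟨a, ha, hfix, -⟩ := hcontr.exists_fixedPoint' Metric.isClosed_closedBall.isComplete
    hmaps ((hmem _).2 hx₀) (edist_ne_top _ _)
  refine ⟨a, (hmem a).1 ha, ?_⟩
  have h1 : ∀ i, r a i = 1 / 2 * ∑ k, w k * r a k := fun i => by
    have := congrFun hfix i
    simp only [hG] at this
    linarith
  -- Averaging the fixed-point equation against w forces the mean of r to vanish, hence r itself.
  have h2 : ∑ k, w k * r a k = 1 / 2 * ∑ k, w k * r a k := by
    conv_lhs => rw [Finset.sum_congr rfl fun k _ => by rw [h1 k]]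
    rw [← Finset.sum_mul, hw1, one_mul]
  funext i
  rw [h1 i, Pi.zero_apply]
  linarith

/-! ### Row sums of the score and existence of a solution -/

namespace SparseRegime

variable {n : ℕ} {X : Matrix (Fin n) (Fin n) ℝ} {ε : Fin n → Fin n → ℝ → ℝ → ℝ} {C e : ℝ}

theorem sum_compl_entry (h : SparseRegime X ε C e) (i : Fin n) :
    ∑ j ∈ {i}ᶜ, X i j = deg X i := by
  have := Fintype.sum_eq_add_sum_compl i (X i)
  rw [h.adj.apply_diag, zero_add] at this
  exact this.symm

theorem sum_compl_pTilde (h : SparseRegime X ε C e) (i : Fin n) :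
    ∑ j ∈ {i}ᶜ, pTilde X i j = deg X i - pTilde X i i := by
  have := Fintype.sum_eq_add_sum_compl i (pTilde X i)
  rw [h.sum_pTilde] at this
  linarith

theorem pTilde_le_mul_deg (h : SparseRegime X ε C e) (i : Fin n) :
    pTilde X i i ≤ e * deg X i := by
  nlinarith [h.pTilde_le i i, h.one_le_deg i, h.e_pos i]

theorem abs_score_alphaTilde_le (h : SparseRegime X ε C e) (i : Fin n) :
    |score X ε (alphaTilde X) i| ≤ 1 / 3 * (10 * (C + 1) * e) * deg X i := by
  have h1 : score X ε (alphaTilde X) i = ∑ j ∈ {i}ᶜ,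
      (scoreTerm X ε i j (alphaTilde X) - (X i j - pTilde X i j)) + pTilde X i i := by
    rw [Finset.sum_sub_distrib, Finset.sum_sub_distrib, h.sum_compl_entry, h.sum_compl_pTilde,
      score]
    ring
  have h2 : |∑ j ∈ {i}ᶜ, (scoreTerm X ε i j (alphaTilde X) - (X i j - pTilde X i j))| ≤
      ∑ j ∈ {i}ᶜ, ((C + 1) * e * X i j + 1.05 * (2 * (C * e) + e) * pTilde X i j) := by
    refine (Finset.abs_sum_le_sum_abs _ _).trans (Finset.sum_le_sum fun j hj => ?_)
    exact h.abs_scoreTerm_alphaTilde_sub_le (by simpa [eq_comm] using hj)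
  rw [Finset.sum_add_distrib, ← Finset.mul_sum, ← Finset.mul_sum, h.sum_compl_entry,
    h.sum_compl_pTilde] at h2
  have hP := h.pTilde_pos i i
  have hP2 := h.pTilde_le_mul_deg i
  have hCe : 0 ≤ C * e := mul_nonneg (h.C_nonneg i) (h.e_pos i).le
  have he := h.e_pos i
  have hd := h.deg_pos i
  have h3 : 0 ≤ (2 * (C * e) + e) * pTilde X i i := by positivity
  have h4 := mul_pos he hd
  have h5 := mul_nonneg hCe hd.le
  rw [h1]
  refine (abs_add_le _ _).trans ?_
  rw [abs_of_pos hP]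
  -- The total is (C+1)e + 1.05(2C+1)e + e = (3.1C + 3.05)e per unit of degree, below (10/3)(C+1)e.
  nlinarith

theorem abs_score_sub_le (h : SparseRegime X ε C e) {α β : Fin n → ℝ}
    (hα : ‖α - alphaTilde X‖ ≤ 10 * (C + 1) * e)
    (hβ : ‖β - alphaTilde X‖ ≤ 10 * (C + 1) * e) (i : Fin n) :
    |score X ε α i - score X ε β i +
        deg X i * ((α - β) i + ∑ k, deg X k / total X * (α - β) k)| ≤
      1 / 3 * ‖α - β‖ * deg X i := by
  set u := α - β with hu
  have h0 : deg X i * ∑ k, deg X k / total X * u k =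
      pTilde X i i * u i + ∑ k ∈ {i}ᶜ, pTilde X i k * u k := by
    rw [Finset.mul_sum, ← Fintype.sum_eq_add_sum_compl i (fun k => pTilde X i k * u k)]
    refine Finset.sum_congr rfl fun k _ => ?_
    rw [pTilde]
    ring
  -- The score omits j = i while the row sum of P includes it, which leaves 2 P_ii u_i.
  have h1 : score X ε α i - score X ε β i + deg X i * (u i + ∑ k, deg X k / total X * u k) =
      ∑ j ∈ {i}ᶜ, (scoreTerm X ε i j α - scoreTerm X ε i j β + pTilde X i j * (u i + u j)) +
        2 * pTilde X i i * u i := by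
    simp only [mul_add, Finset.sum_add_distrib, Finset.sum_sub_distrib]
    rw [h0, ← Finset.sum_mul, h.sum_compl_pTilde, score, score]
    ring
  have h2 : |∑ j ∈ {i}ᶜ, (scoreTerm X ε i j α - scoreTerm X ε i j β +
      pTilde X i j * (u i + u j))| ≤
      ∑ j ∈ {i}ᶜ, (0.012 * X i j + 1 / 4 * pTilde X i j) * ‖u‖ := by
    refine (Finset.abs_sum_le_sum_abs _ _).trans (Finset.sum_le_sum fun j hj => ?_)
    exact h.abs_scoreTerm_sub_le (by simpa [eq_comm] using hj) hα hβ
  have hsum : ∑ j ∈ {i}ᶜ, (0.012 * X i j + 1 / 4 * pTilde X i j) * ‖u‖ =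
      (0.012 * deg X i + 1 / 4 * (deg X i - pTilde X i i)) * ‖u‖ := by
    rw [← Finset.sum_mul, Finset.sum_add_distrib, ← Finset.mul_sum, ← Finset.mul_sum,
      h.sum_compl_entry, h.sum_compl_pTilde]
  rw [hsum] at h2
  have hP := h.pTilde_pos i i
  have hd := h.deg_pos i
  have hui : |u i| ≤ ‖u‖ := norm_le_pi_norm u i
  have h3 : |2 * pTilde X i i * u i| ≤ 2 * (1 / 225 * deg X i) * ‖u‖ := by
    rw [abs_mul, abs_of_pos (by positivity)]
    have : pTilde X i i ≤ 1 / 225 * deg X i :=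
      (h.pTilde_le_mul_deg i).trans (mul_le_mul_of_nonneg_right (h.e_le i) hd.le)
    gcongr
  rw [h1]
  refine (abs_add_le _ _).trans ((add_le_add h2 h3).trans ?_)
  -- Here 0.012 + 1/4 + 2/225 < 1/3.
  nlinarith [mul_nonneg hP.le (norm_nonneg u), mul_nonneg hd.le (norm_nonneg u)]

theorem exists_solution (h : SparseRegime X ε C e) (hn : 0 < n) :
    ∃ α : Fin n → ℝ, SolvesLikelihoodEq X ε α ∧
      ‖α - alphaTilde X‖ ≤ 10 * (C + 1) * e := by
  have i₀ : Fin n := ⟨0, hn⟩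
  have hδ : 0 ≤ 10 * (C + 1) * e :=
    mul_nonneg (by linarith [h.C_nonneg i₀]) (h.e_pos i₀).le
  have hT := h.total_pos i₀
  have hw1 : ∑ k, deg X k / total X = 1 := by
    rw [← Finset.sum_div]
    exact div_self hT.ne'
  obtain ⟨α, hα, hz⟩ := exists_zero_of_approx_rank_one (w := fun k => deg X k / total X)
    (r := fun a i => score X ε a i / deg X i) (x₀ := alphaTilde X)
    (fun k => (div_pos (h.deg_pos k) hT).le) hw1 hδ
    (fun a b ha hb i => by
      have hd := h.deg_pos i
      have h1 := h.abs_score_sub_le ha hb i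
      rw [← div_le_iff₀ hd, ← abs_of_pos hd, ← abs_div, abs_of_pos hd] at h1
      refine le_of_eq_of_le (congrArg _ ?_) h1
      rw [add_div, mul_div_cancel_left₀ _ hd.ne', sub_div])
    (fun i => by
      have hd := h.deg_pos i
      have h1 := h.abs_score_alphaTilde_le i
      rwa [← div_le_iff₀ hd, ← abs_of_pos hd, ← abs_div] at h1)
  refine ⟨α, ⟨fun i j hij => h.prob_lt_one hij hα,
    hasFDerivAt_logLik h.adj.symm h.smooth (fun i j hij => h.prob_lt_one hij hα) fun i => ?_⟩, hα⟩
  have := congrFun hz i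
  exact (div_eq_zero_iff.1 this).resolve_right (h.deg_pos i).ne'

/-! ### Comparison of the log-likelihoods -/

theorem sum_Ioi_entry (h : SparseRegime X ε C e) :
    ∑ i, ∑ j ∈ Finset.Ioi i, X i j = total X / 2 := by
  have h1 := Finset.sum_sum_Ioi_add_eq_sum_sum_off_diag fun j i => X i j
  have h2 : ∑ i, ∑ j ∈ {i}ᶜ, X i j = total X := Finset.sum_congr rfl fun i _ => h.sum_compl_entry i
  have h3 : ∑ i, ∑ j ∈ Finset.Ioi i, (X i j + X j i) = 2 * ∑ i, ∑ j ∈ Finset.Ioi i, X i j := by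
    simp only [Finset.mul_sum]
    refine Finset.sum_congr rfl fun i _ => Finset.sum_congr rfl fun j _ => ?_
    rw [h.adj.symm.apply i j]
    ring
  linarith

theorem sum_Ioi_pTilde_le (h : SparseRegime X ε C e) :
    ∑ i, ∑ j ∈ Finset.Ioi i, pTilde X i j ≤ total X / 2 := by
  have h1 := Finset.sum_sum_Ioi_add_eq_sum_sum_off_diag fun j i => pTilde X i j
  have h2 : ∑ i, ∑ j ∈ {i}ᶜ, pTilde X i j ≤ total X := Finset.sum_le_sum fun i _ => by
    rw [h.sum_compl_pTilde]
    linarith [h.pTilde_pos i i, show deg X i = ∑ j, X i j from rfl]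
  have h3 : ∑ i, ∑ j ∈ Finset.Ioi i, (pTilde X i j + pTilde X j i) =
      2 * ∑ i, ∑ j ∈ Finset.Ioi i, pTilde X i j := by
    simp only [Finset.mul_sum]
    refine Finset.sum_congr rfl fun i _ => Finset.sum_congr rfl fun j _ => ?_
    rw [pTilde, pTilde]
    ring
  linarith

/-- Since P_ij ≤ 1/225 < exp(-1), each edge contributes at most -1, and non-edges contribute at most
0. -/
theorem logLik_pTilde_le (h : SparseRegime X ε C e) :
    logLik X (pTilde X) ≤ -(total X / 2) := by
  rw [← h.sum_Ioi_entry, logLik, ← Finset.sum_neg_distrib]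
  refine Finset.sum_le_sum fun i _ => ?_
  rw [← Finset.sum_neg_distrib]
  refine Finset.sum_le_sum fun j _ => ?_
  have hP := h.pTilde_pos i j
  have hP2 := (h.pTilde_le i j).trans (h.e_le i)
  have h1 : Real.log (pTilde X i j) ≤ -1 := by
    rw [Real.log_le_iff_le_exp hP, Real.exp_neg]
    refine hP2.trans ?_
    rw [one_div]
    exact inv_anti₀ (Real.exp_pos 1) (by linarith [Real.exp_one_lt_d9])
  have h2 : Real.log (1 - pTilde X i j) ≤ 0 := Real.log_nonpos (by linarith) (by linarith)
  nlinarith [mul_le_mul_of_nonneg_left h1 (h.entry_nonneg i j),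
    mul_nonpos_of_nonneg_of_nonpos (sub_nonneg.2 (h.entry_le_one i j)) h2]

theorem abs_log_one_sub_sub_le {p q : ℝ} (hp : p ≤ 1 / 100) (hq : q ≤ 1 / 100) :
    |Real.log (1 - p) - Real.log (1 - q)| ≤ 100 / 99 * |p - q| := by
  have key : ∀ {p q : ℝ}, p ≤ 1 / 100 → q ≤ 1 / 100 →
      Real.log (1 - p) - Real.log (1 - q) ≤ 100 / 99 * |p - q| := by
    intro p q hp hq
    rw [← Real.log_div (by linarith) (by linarith)]
    refine (Real.log_le_sub_one_of_pos (div_pos (by linarith) (by linarith))).trans ?_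
    rw [sub_le_iff_le_add, div_le_iff₀ (by linarith)]
    nlinarith [neg_abs_le (p - q), abs_nonneg (p - q)]
  rw [abs_le]
  refine ⟨?_, key hp hq⟩
  have := key hq hp
  rw [abs_sub_comm] at this
  linarith

/-- An edge sees the change of log p, at most 20(C+1)e + 1.1Ce. A non-edge sees that of log(1 - p),
at most 100/99 · 1.1 · 21.1 (C+1)e P_ij, where 24 bounds the constant. -/
theorem abs_logLik_pair_sub_le (h : SparseRegime X ε C e) {α : Fin n → ℝ}
    (hα : ‖α - alphaTilde X‖ ≤ 10 * (C + 1) * e) {i j : Fin n} (hij : i ≠ j) :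
    |(X i j * Real.log (prob ε α i j) + (1 - X i j) * Real.log (1 - prob ε α i j)) -
      (X i j * Real.log (pTilde X i j) + (1 - X i j) * Real.log (1 - pTilde X i j))| ≤
      21.1 * (C + 1) * e * X i j + 24 * (C + 1) * e * pTilde X i j := by
  have he := h.e_pos i
  have hP := h.pTilde_pos i j
  have hPe := (h.pTilde_le i j).trans (h.e_le i)
  have hc : 0 < (C + 1) * e := mul_pos (by linarith [h.C_nonneg i]) he
  have hx : 20 * (C + 1) * e + 1.1 * (C * e) ≤ 21.1 * (C + 1) * e := by linarith
  rcases h.adj.zero_or_one i j with h0 | h0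
  · have h1 := h.abs_prob_sub_le hij hα
    have h2 := abs_log_one_sub_sub_le (p := prob ε α i j) (q := pTilde X i j)
      (by linarith [h.prob_le hij hα]) (by linarith)
    have h3 := mul_le_mul_of_nonneg_right hx hP.le
    have h4 := mul_pos hc hP
    rw [h0]
    simp only [zero_mul, zero_add, sub_zero, one_mul, mul_zero]
    linarith
  · have h1 := (h.abs_log_prob_sub_le hij hα).trans hx
    have h4 := mul_pos hc hP
    rw [h0, h.log_pTilde, prob, Real.log_exp]
    simp only [sub_self, zero_mul, add_zero, one_mul]
    linarith

theorem abs_logLik_sub_le (h : SparseRegime X ε C e) {α : Fin n → ℝ}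
    (hα : ‖α - alphaTilde X‖ ≤ 10 * (C + 1) * e) (hn : 0 < n) :
    |logLik X (prob ε α) - logLik X (pTilde X)| ≤ 49 * (C + 1) * e * (total X / 2) := by
  have i₀ : Fin n := ⟨0, hn⟩
  have hc : 0 < (C + 1) * e := mul_pos (by linarith [h.C_nonneg i₀]) (h.e_pos i₀)
  have h1 : |logLik X (prob ε α) - logLik X (pTilde X)| ≤ ∑ i, ∑ j ∈ Finset.Ioi i,
      (21.1 * (C + 1) * e * X i j + 24 * (C + 1) * e * pTilde X i j) := by
    rw [logLik, logLik, ← Finset.sum_sub_distrib]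
    refine (Finset.abs_sum_le_sum_abs _ _).trans (Finset.sum_le_sum fun i _ => ?_)
    rw [← Finset.sum_sub_distrib]
    refine (Finset.abs_sum_le_sum_abs _ _).trans (Finset.sum_le_sum fun j hj => ?_)
    exact h.abs_logLik_pair_sub_le hα (Finset.mem_Ioi.1 hj).ne
  simp only [Finset.sum_add_distrib, ← Finset.mul_sum] at h1
  rw [h.sum_Ioi_entry] at h1
  have h2 := mul_le_mul_of_nonneg_left h.sum_Ioi_pTilde_le hc.le
  have h3 := mul_pos hc (h.total_pos i₀)
  -- Both sums are at most `total X / 2`, and 21.1 + 24 < 49.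
  linarith

end SparseRegime

end NullModel

theorem corollary2 (n : ℕ) (hn : 0 < n)
    (X : Matrix (Fin n) (Fin n) ℝ) (hX : X.IsAdjMatrix)
    (ε : Fin n → Fin n → ℝ → ℝ → ℝ) (hε : NullModel.IsSmoothFamily ε)
    (C₀ : ℝ) (hC₀ : NullModel.SubExponential ε C₀)
    (ε₀ : ℝ)
    (hdeg : ∀ i, 1 ≤ NullModel.deg X i ^ 2 ∧ NullModel.deg X i ^ 2 ≤ ε₀ * NullModel.total X)
    (hε₀ : ε₀ ≤ ((15 * (C₀ + 1)) ^ 2)⁻¹) :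
    (∃ αhat : Fin n → ℝ, NullModel.SolvesLikelihoodEq X ε αhat ∧
        ‖αhat - NullModel.alphaTilde X‖ ≤ 10 * (C₀ + 1) * ε₀) ∧
      NullModel.logLik X (NullModel.pTilde X) ≠ 0 ∧
      ∀ αhat : Fin n → ℝ, NullModel.SolvesLikelihoodEq X ε αhat →
        ‖αhat - NullModel.alphaTilde X‖ ≤ 10 * (C₀ + 1) * ε₀ →
        |(NullModel.logLik X (NullModel.prob ε αhat) - NullModel.logLik X (NullModel.pTilde X)) /
            NullModel.logLik X (NullModel.pTilde X)| ≤ 49 * (C₀ + 1) * ε₀ := by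
  have h : NullModel.SparseRegime X ε C₀ ε₀ := ⟨hX, hε, hC₀, hdeg, hε₀⟩
  have hT : 0 < NullModel.total X := h.total_pos ⟨0, hn⟩
  have hneg := h.logLik_pTilde_le
  have hlt : NullModel.logLik X (NullModel.pTilde X) < 0 := by linarith
  refine ⟨h.exists_solution hn, hlt.ne, fun αhat _ hα => ?_⟩
  have hc : 0 ≤ 49 * (C₀ + 1) * ε₀ :=
    mul_nonneg (by linarith [h.C_nonneg ⟨0, hn⟩]) (h.e_pos ⟨0, hn⟩).le
  rw [abs_div, abs_of_neg hlt, div_le_iff₀ (by linarith)]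
  exact (h.abs_logLik_sub_le hα hn).trans (mul_le_mul_of_nonneg_left (by linarith) hc)
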